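/- A category $\mathcal K$ is \emph{weakly locally finitely presentable} if it is finitely accessible and every small diagram $F$ in it has a weak colimit, i.e. a cocone through which every cocone under $F$ factors, not necessarily uniquely. A full subcategory of a locally finitely presentable category $\mathcal K$ is a \emph{definable subcategory} if it is closed in $\mathcal K$ under (small) products, (small) directed colimits and pure subobjects, where a morphism $f\colon A\to B$ is pure if for all $g\colon X\to Y$ with $X,Y$ finitely presentable and all $u\colon X\to A$, $w\colon Y\to B$ with $fu=wg$, the morphism $u$ factors through $g$. A category is \emph{definable} if it is equivalent to a definable subcategory of some locally finitely presentable category. A class of objects of $\mathcal K$ is a \emph{finite-injectivity class} if there is a set $\mathcal M$ of morphisms with finitely presentable domains and codomains such that the class consists precisely of those objects $X$ that are injective with respect to every $h\colon A\to B$ in $\mathcal M$ (every morphism $A\to X$ factors through $h$). \textbf{Proposition.} Every weakly locally finitely presentable category $\mathcal L$ is definable. More precisely, $\mathcal L$ is equivalent to $\operatorname{Ind}\mathcal C$ for some small category $\mathcal C$, and for every small category $\mathcal C$ with $\mathcal L\simeq\operatorname{Ind}\mathcal C$, the presheaves on $\mathcal C$ isomorphic to an object in the image of the canonical full embedding $\operatorname{Ind}\mathcal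 C\to\mathbf{Set}^{\mathcal C^{op}}$ form a finite-injectivity class in $\mathbf{Set}^{\mathcal C^{op}}$. -/

import Mathlib

universe v u

open CategoryTheory CategoryTheory.Limits

namespace DefinableCat

/-- A cocone `c` under `F` is a weak colimit of `F` if every cocone under `F` factors through `c`
(not necessarily uniquely). -/
def IsWeakColimit {J : Type*} [Category* J] {K : Type*} [Category* K] {F : J ⥤ K}
    (c : Cocone F) : Prop :=
  ∀ s : Cocone F, ∃ d : c.pt ⟶ s.pt, ∀ j : J, c.ι.app j ≫ d = s.ι.app j

/-- The category `K`, with hom-sets in `Type v`, has weak colimits of all small diagrams. -/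
def HasWeakColimits (K : Type u) [Category.{v} K] : Prop :=
  ∀ (J : Type v) [SmallCategory J] (F : J ⥤ K), ∃ c : Cocone F, IsWeakColimit c

/-- A category is weakly locally finitely presentable if it is finitely accessible
and has weak colimits. -/
structure IsWeaklyLocallyFinitelyPresentable (K : Type u) [Category.{v} K] : Prop where
  isFinitelyAccessible : IsFinitelyAccessibleCategory.{v} K
  hasWeakColimits : HasWeakColimits K

/-- A morphism `f : A ⟶ B` is pure if in each commutative square `u ≫ f = g ≫ w` with
`g : X ⟶ Y` a morphism between finitely presentable objects, `u : X ⟶ A` factors through `g`.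
(In a finitely accessible category, such morphisms are automatically monomorphisms, so a
pure subobject of `B` is the same thing as a pure morphism with target `B`.) -/
def IsPure {K : Type u} [Category.{v} K] {A B : K} (f : A ⟶ B) : Prop :=
  ∀ ⦃X Y : K⦄, IsFinitelyPresentable.{v} X → IsFinitelyPresentable.{v} Y →
    ∀ (g : X ⟶ Y) (u : X ⟶ A) (w : Y ⟶ B), u ≫ f = g ≫ w → ∃ t : Y ⟶ A, g ≫ t = u

/-- The full subcategory of `K` on the objects satisfying `P` is closed in `K` under small
products, colimits of (nonempty) small directed diagrams, and pure subobjects. -/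
structure IsDefinableSubcategory {K : Type u} [Category.{v} K] (P : ObjectProperty K) :
    Prop where
  closed_products : ∀ I : Type v, P.IsClosedUnderLimitsOfShape (Discrete I)
  closed_directedColimits : ∀ (I : Type v) [PartialOrder I] [IsDirectedOrder I] [Nonempty I],
    P.IsClosedUnderColimitsOfShape I
  closed_pureSubobjects : ∀ ⦃A B : K⦄ (f : A ⟶ B), IsPure f → P B → P A

/-- A category is definable if it is equivalent to a definable subcategory of a locally
finitely presentable category. -/
def IsDefinable (L : Type u) [Category.{v} L] : Prop :=
  ∃ (K : Type (v + 1)) (_ : Category.{v} K) (P : ObjectProperty K),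
    IsLocallyFinitelyPresentable.{v} K ∧ IsDefinableSubcategory P ∧
      Nonempty (L ≌ P.FullSubcategory)

/-- The object `X` is injective with respect to the morphism `h`. -/
def IsInjectiveWrt {K : Type u} [Category.{v} K] (X : K) {A B : K} (h : A ⟶ B) : Prop :=
  ∀ a : A ⟶ X, ∃ b : B ⟶ X, h ≫ b = a

/-- The objects satisfying `P` are precisely those that are injective with respect to all
morphisms of some (small) set `M` of morphisms with finitely presentable domains and codomains. -/
def IsFiniteInjectivityClass {K : Type u} [Category.{v} K] (P : ObjectProperty K) : Prop :=
  ∃ M : MorphismProperty K, MorphismProperty.IsSmall.{v} M ∧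
    (∀ ⦃A B : K⦄ (h : A ⟶ B), M h → IsFinitelyPresentable.{v} A ∧ IsFinitelyPresentable.{v} B) ∧
    ∀ X : K, P X ↔ ∀ ⦃A B : K⦄ (h : A ⟶ B), M h → IsInjectiveWrt X h

end DefinableCat

namespace DefinableCat

section Definable

variable {K : Type u} [Category.{v} K]

/-! A presheaf `P` on `C` is an ind-object iff its category of elements is filtered, i.e. has
cocones over diagrams of three finite shapes. A diagram of elements lying over `D : J ⥤ C` is a map
from `colimit (D ⋙ yoneda)` to `P`, and it acquires a cocone once this map factors through a
representable. A weak colimit of `D` in `Ind C` is a filtered colimit of representables, so its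
cocone factors through one of them. This yields a single cocone in `C` that works for all
ind-objects at once (`exists_cocone_of_hasWeakColimits`), hence a set of morphisms testing
ind-objects by injectivity. Definability follows, since finite-injectivity classes have the required
closure properties. -/

lemma IsFiniteInjectivityClass.isDefinableSubcategory {P : ObjectProperty K}
    (hP : IsFiniteInjectivityClass P) : IsDefinableSubcategory P := by
  obtain ⟨M, -, hM, h⟩ := hP
  refine ⟨fun I ↦ ⟨?_⟩, fun I _ _ _ ↦ ⟨?_⟩, fun A B f hf hB ↦ ?_⟩
  · rintro X ⟨p⟩
    refine (h X).2 fun A B g hg a ↦ ?_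
    choose b hb using fun i ↦ (h _).1 (p.prop_diag_obj i) g hg (a ≫ p.π.app i)
    refine ⟨p.isLimit.lift ⟨B, Discrete.natTrans b⟩, p.isLimit.hom_ext fun i ↦ ?_⟩
    rw [Category.assoc, p.isLimit.fac]
    exact hb i
  · rintro X ⟨p⟩
    refine (h X).2 fun A B g hg a ↦ ?_
    have := (hM g hg).1
    obtain ⟨i, a', ha'⟩ := IsFinitelyPresentable.exists_hom_of_isColimit p.isColimit a
    obtain ⟨b, hb⟩ := (h _).1 (p.prop_diag_obj i) g hg a'
    refine ⟨b ≫ p.ι.app i, ?_⟩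
    rw [← Category.assoc, hb]
    exact ha'
  · refine (h A).2 fun X Y g hg u ↦ ?_
    obtain ⟨w, hw⟩ := (h B).1 hB g hg (u ≫ f)
    exact hf (hM g hg).1 (hM g hg).2 g u w hw.symm

/-- Needed because the finite shapes used below live in `Type` rather than `Type v`. -/
lemma HasWeakColimits.exists_isWeakColimit (hK : HasWeakColimits K) {J : Type*} [Category* J]
    [EssentiallySmall.{v} J] (F : J ⥤ K) : ∃ c : Cocone F, IsWeakColimit c := by
  let e := equivSmallModel.{v} J
  obtain ⟨c, hc⟩ := hK (SmallModel.{v} J) (e.inverse ⋙ F)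
  refine ⟨⟨c.pt,
    { app j := F.map (e.unit.app j) ≫ c.ι.app (e.functor.obj j)
      naturality j k f := ?_ }⟩, fun s ↦ ?_⟩
  · have h := c.w (e.functor.map f)
    have h' := congr_arg F.map (e.unit.naturality f)
    dsimp at h h' ⊢
    rw [Functor.map_comp, Functor.map_comp] at h'
    rw [reassoc_of% h', h, Category.comp_id]
  · obtain ⟨d, hd⟩ := hc (s.whisker e.inverse)
    refine ⟨d, fun j ↦ ?_⟩
    rw [Category.assoc, hd]
    exact s.w _

lemma HasWeakColimits.of_equivalence {L : Type*} [Category.{v} L] (e : K ≌ L)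
    (hK : HasWeakColimits K) : HasWeakColimits L := by
  intro J _ F
  obtain ⟨c, hc⟩ := hK J (F ⋙ e.inverse)
  let α (j : J) : e.functor.obj (e.inverse.obj (F.obj j)) ≅ F.obj j := e.counitIso.app _
  refine ⟨⟨e.functor.obj c.pt,
    { app j := e.counitInv.app _ ≫ e.functor.map (c.ι.app j)
      naturality i j f := ?_ }⟩, fun s ↦ ?_⟩
  · have := congr_arg e.functor.map (c.ι.naturality f)
    simp only [Functor.const_obj_obj, Functor.const_obj_map, Category.comp_id] at this ⊢
    rw [← this]
    simp
  · obtain ⟨d, hd⟩ := hc (e.inverse.mapCocone s)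
    refine ⟨e.functor.map d ≫ e.counit.app _, fun j ↦ ?_⟩
    have := congr_arg e.functor.map (hd j)
    dsimp at this ⊢
    rw [Category.assoc, ← Functor.map_comp_assoc, hd]
    simp

end Definable

lemma isSmall_sup {K : Type u} [Category.{v} K] {M N : MorphismProperty K}
    (hM : MorphismProperty.IsSmall.{v} M) (hN : MorphismProperty.IsSmall.{v} N) :
    MorphismProperty.IsSmall.{v} (M ⊔ N) :=
  ⟨inferInstanceAs (Small.{v} (M.toSet ∪ N.toSet : Set (Arrow K)))⟩

section Ind

variable {C : Type v} [SmallCategory C]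

lemma essImage_indInclusion : (Ind.inclusion C).essImage = IsIndObject (C := C) := by
  ext P
  refine ⟨fun ⟨X, ⟨e⟩⟩ ↦ X.isIndObject_inclusion_obj.map e.hom, fun h ↦ ?_⟩
  exact ⟨(Ind.equivalence C).inverse.obj ⟨P, h⟩,
    ⟨(ObjectProperty.ι _).mapIso ((Ind.equivalence C).counitIso.app ⟨P, h⟩)⟩⟩

instance (c : C) : IsFinitelyPresentable.{v} (yoneda.obj c) :=
  have : Fact (Cardinal.aleph0.{v}).IsRegular := ⟨Cardinal.isRegular_aleph0⟩
  ⟨fun J _ _ ↦ preservesColimitsOfShape_of_natIso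
    (F := (evaluation _ _).obj (.op c))
    (NatIso.ofComponents fun P ↦ Equiv.toIso yonedaEquiv.symm)⟩

lemma isFinitelyPresentable_colimit_comp_yoneda {J : Type} [SmallCategory J] [FinCategory J]
    (D : J ⥤ C) : IsFinitelyPresentable.{v} (colimit (D ⋙ yoneda)) := by
  have : Fact (Cardinal.aleph0.{v}).IsRegular := ⟨Cardinal.isRegular_aleph0⟩
  have (j : J) : IsCardinalPresentable ((D ⋙ yoneda).obj j) Cardinal.aleph0.{v} :=
    inferInstanceAs (IsFinitelyPresentable.{v} (yoneda.obj (D.obj j)))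
  exact isCardinalPresentable_of_isColimit _ (colimit.isColimit (D ⋙ yoneda)) _
    (by rw [hasCardinalLT_aleph0_iff]; infer_instance)

/-- Finite diagrams in `C` have weak colimits in `Ind C` which belong to `C`. -/
lemma exists_cocone_of_hasWeakColimits (hC : HasWeakColimits (Ind C))
    {J : Type} [SmallCategory J] [FinCategory J] (D : J ⥤ C) :
    ∃ c : Cocone D, ∀ P : Cᵒᵖ ⥤ Type v, IsIndObject P →
      IsInjectiveWrt P (colimit.desc (D ⋙ yoneda) (yoneda.mapCocone c)) := by
  obtain ⟨W, hW⟩ := hC.exists_isWeakColimit (D ⋙ Ind.yoneda)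
  let φ (j : J) : Ind.yoneda.obj (D.obj j) ⟶ W.pt := W.ι.app j
  let ψ (j : J) : yoneda.obj (D.obj j) ⟶ (Ind.inclusion C).obj W.pt :=
    Ind.yonedaCompInclusion.inv.app _ ≫ (Ind.inclusion C).map (φ j)
  have := W.pt.isIndObject_inclusion_obj.isFiltered
  let F : J ⥤ CostructuredArrow yoneda ((Ind.inclusion C).obj W.pt) :=
    { obj j := CostructuredArrow.mk (ψ j)
      map {i j} f := CostructuredArrow.homMk (D.map f) (by
        have h := W.w f
        dsimp at h ⊢
        have h' := Ind.yonedaCompInclusion.inv.naturality (D.map f)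
        dsimp at h'
        simp only [ψ, φ]
        rw [reassoc_of% h', ← Functor.map_comp, h])
      map_id _ := by ext; simp
      map_comp _ _ := by ext; simp }
  -- The elements of an ind-object form a filtered category, so the finite diagram `F` of elements
  -- has a cocone. Its apex `q` is the representable through which the weak colimit cocone factors.
  obtain ⟨c⟩ := IsFiltered.cocone_nonempty F
  let q : yoneda.obj c.pt.left ⟶ (Ind.inclusion C).obj W.pt := c.pt.hom
  refine ⟨⟨c.pt.left, { app j := (c.ι.app j).left, naturality i j f := ?_ }⟩, fun P hP a ↦ ?_⟩
  · exact congr_arg CommaMorphism.left (c.ι.naturality f)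
  · obtain ⟨X, ⟨e⟩⟩ : (Ind.inclusion C).essImage P := by rwa [essImage_indInclusion]
    let s : Cocone (D ⋙ Ind.yoneda) :=
      { pt := X
        ι :=
          { app j := (Ind.inclusion C).preimage (Ind.yonedaCompInclusion.hom.app _ ≫
              colimit.ι (D ⋙ yoneda) j ≫ a ≫ e.inv)
            naturality i j f := (Ind.inclusion C).map_injective <| by
              have h := Ind.yonedaCompInclusion.hom.naturality (D.map f)
              have h' := colimit.w (D ⋙ yoneda) f
              dsimp at h h' ⊢
              rw [Category.comp_id, Functor.map_comp, Functor.map_preimage, Functor.map_preimage,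
                reassoc_of% h, reassoc_of% h'] } }
    obtain ⟨d, hd⟩ := hW s
    refine ⟨q ≫ (Ind.inclusion C).map d ≫ e.hom, colimit.hom_ext fun j ↦ ?_⟩
    have h₁ : yoneda.map (c.ι.app j).left ≫ q = ψ j := CostructuredArrow.w (c.ι.app j)
    have h₂ : (Ind.inclusion C).map (φ j) ≫ (Ind.inclusion C).map d =
        Ind.yonedaCompInclusion.hom.app _ ≫ colimit.ι (D ⋙ yoneda) j ≫ a ≫ e.inv := by
      rw [← Functor.map_comp, hd, Functor.map_preimage]
    rw [colimit.ι_desc_assoc]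
    change yoneda.map (c.ι.app j).left ≫ q ≫ _ = _
    rw [reassoc_of% h₁]
    simp [ψ, reassoc_of% h₂]

/-- The structure maps of `F` glue to a map from the colimit to `P`; its extension along the given
morphism is the apex of the cocone. -/
lemma nonempty_cocone_of_isInjectiveWrt {P : Cᵒᵖ ⥤ Type v} {J : Type} [SmallCategory J]
    (F : J ⥤ CostructuredArrow yoneda P) (c : Cocone (F ⋙ CostructuredArrow.proj _ _))
    (h : IsInjectiveWrt P (colimit.desc _ (yoneda.mapCocone c))) : Nonempty (Cocone F) := by
  obtain ⟨b, hb⟩ := h (colimit.desc _ ⟨P,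
    { app j := (F.obj j).hom
      naturality j k f := (CostructuredArrow.w (F.map f)).trans (Category.comp_id _).symm }⟩)
  have hb' (j : J) : yoneda.map (c.ι.app j) ≫ b = (F.obj j).hom := by
    have := colimit.ι _ j ≫= hb
    rw [colimit.ι_desc_assoc, colimit.ι_desc] at this
    exact this
  exact ⟨⟨CostructuredArrow.mk b,
    { app j := CostructuredArrow.homMk (c.ι.app j) (hb' j)
      naturality i j f := by
        ext
        exact c.ι.naturality f }⟩⟩

theorem isFiniteInjectivityClass_isIndObject (hC : HasWeakColimits (Ind C)) :
    IsFiniteInjectivityClass (IsIndObject (C := C)) := by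
  choose c hc using fun (J : Type) [SmallCategory J] [FinCategory J] (D : J ⥤ C) ↦
    exists_cocone_of_hasWeakColimits hC D
  let M (J : Type) [SmallCategory J] [FinCategory J] : MorphismProperty (Cᵒᵖ ⥤ Type v) :=
    .ofHoms fun D : J ⥤ C ↦ colimit.desc (D ⋙ yoneda) (yoneda.mapCocone (c J D))
  have hMs (J : Type) [SmallCategory J] [FinCategory J] : MorphismProperty.IsSmall.{v} (M J) :=
    inferInstance
  have hMf (J : Type) [SmallCategory J] [FinCategory J] ⦃A B : Cᵒᵖ ⥤ Type v⦄ (h : A ⟶ B)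
      (hM : M J h) : IsFinitelyPresentable.{v} A ∧ IsFinitelyPresentable.{v} B := by
    obtain ⟨D⟩ := hM
    exact ⟨isFinitelyPresentable_colimit_comp_yoneda D,
      inferInstanceAs (IsFinitelyPresentable.{v} (yoneda.obj _))⟩
  have hMi (J : Type) [SmallCategory J] [FinCategory J] (P : Cᵒᵖ ⥤ Type v) (hP : IsIndObject P)
      ⦃A B : Cᵒᵖ ⥤ Type v⦄ (h : A ⟶ B) (hM : M J h) : IsInjectiveWrt P h := by
    obtain ⟨D⟩ := hM
    exact hc J D P hP
  have hMc (J : Type) [SmallCategory J] [FinCategory J] (P : Cᵒᵖ ⥤ Type v)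
      (hP : ∀ ⦃A B : Cᵒᵖ ⥤ Type v⦄ (h : A ⟶ B), M J h → IsInjectiveWrt P h)
      (F : J ⥤ CostructuredArrow yoneda P) : Nonempty (Cocone F) :=
    nonempty_cocone_of_isInjectiveWrt F (c J _) (hP _ ⟨_⟩)
  -- Cocones over these three shapes are exactly the axioms of filteredness.
  refine ⟨M (Discrete PEmpty) ⊔ M (Discrete WalkingPair) ⊔ M WalkingParallelPair, isSmall_sup (isSmall_sup (hMs _) (hMs _)) (hMs _),
    ?_, fun P ↦ ⟨?_, ?_⟩⟩
  · rintro A B h ((hM | hM) | hM) <;> exact hMf _ _ hM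
  · rintro hP A B h ((hM | hM) | hM) <;> exact hMi _ _ hP _ hM
  · intro hP
    have h₁ := hMc (Discrete PEmpty) P fun A B h hM ↦ hP h (.inl (.inl hM))
    have h₂ := hMc (Discrete WalkingPair) P fun A B h hM ↦ hP h (.inl (.inr hM))
    have h₃ := hMc WalkingParallelPair P fun A B h hM ↦ hP h (.inr hM)
    have : IsFiltered (CostructuredArrow yoneda P) :=
      { nonempty := (h₁ (Functor.empty _)).map Cocone.pt
        cocone_objs X Y := by
          obtain ⟨s⟩ := h₂ (pair X Y)
          exact ⟨s.pt, s.ι.app ⟨.left⟩, s.ι.app ⟨.right⟩, trivial⟩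
        cocone_maps X Y f g := by
          obtain ⟨s⟩ := h₃ (parallelPair f g)
          exact ⟨s.pt, s.ι.app .one,
            (s.w WalkingParallelPairHom.left).trans (s.w WalkingParallelPairHom.right).symm⟩ }
    have := finallySmall_of_essentiallySmall.{v} (CostructuredArrow yoneda P)
    exact isIndObject_of_isFiltered_of_finallySmall P

end Ind

section RestrictedYoneda

variable {L : Type u} [Category.{v} L] {C : Type v} [SmallCategory C] (i : C ⥤ L)

/-- The functor sending `X` to the presheaf `Hom(i -, X)`. -/
abbrev restrictedYoneda : L ⥤ Cᵒᵖ ⥤ Type v :=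
  yoneda ⋙ (Functor.whiskeringLeft _ _ _).obj i.op

instance [i.IsDense] : (restrictedYoneda i).Faithful where
  map_injective {X Y f g} h := (i.denseAt X).hom_ext' fun c p ↦ by
    have h' : p ≫ f = p ≫ g := ConcreteCategory.congr_hom (NatTrans.congr_app h (.op c)) p
    exact congrArg (fun t ↦ 𝟙 (i.obj c) ≫ t) h'

/-- A natural transformation to the presheaf of `Y` is a cocone with point `Y` over the canonical
diagram of `X`, whose colimit is `X` by density. -/
instance [i.IsDense] : (restrictedYoneda i).Full where
  map_surjective {X Y} f := by
    let s : Cocone (CostructuredArrow.proj i X ⋙ i) :=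
      { pt := Y
        ι :=
          { app g := f.app (.op g.left) g.hom
            naturality g₁ g₂ φ := by
              have h : f.app (.op g₁.left) (i.map φ.left ≫ g₂.hom) =
                  i.map φ.left ≫ f.app (.op g₂.left) g₂.hom :=
                ConcreteCategory.congr_hom (f.naturality φ.left.op) g₂.hom
              rw [CostructuredArrow.w φ] at h
              exact h.symm.trans (Category.comp_id _).symm } }
    refine ⟨(i.denseAt X).desc s, ?_⟩
    ext ⟨c⟩ (g : i.obj c ⟶ X)
    have h : (𝟙 _ ≫ g) ≫ (i.denseAt X).desc s = f.app (.op c) g := (i.denseAt X).fac s (.mk g)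
    rwa [Category.id_comp] at h

/-- For `i` fully faithful, the restricted Yoneda functor extends the Yoneda embedding of `C`. -/
noncomputable def compRestrictedYonedaIso [i.Full] [i.Faithful] : i ⋙ restrictedYoneda i ≅ yoneda :=
  NatIso.ofComponents fun c ↦ NatIso.ofComponents fun d ↦
    (Functor.FullyFaithful.ofFullyFaithful i).homEquiv.symm.toIso

lemma preservesColimitsOfShape_restrictedYoneda (hi : ∀ c, IsFinitelyPresentable.{v} (i.obj c))
    (J : Type v) [SmallCategory J] [IsFiltered J] :
    PreservesColimitsOfShape J (restrictedYoneda i) := by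
  refine preservesColimitsOfShape_of_evaluation _ _ fun c ↦ ?_
  have := hi c.unop
  exact inferInstanceAs (PreservesColimitsOfShape J (coyoneda.obj (.op (i.obj c.unop))))

end RestrictedYoneda

variable (L : Type u) [Category.{v} L]

lemma exists_equivalence_ind (hL : IsFinitelyAccessibleCategory.{v} L) :
    ∃ (C : Type v) (_ : SmallCategory C), Nonempty (L ≌ Ind C) := by
  let P := ObjectProperty.isFinitelyPresentable.{v} L
  let C := SmallModel.{v} P.FullSubcategory
  let i : C ⥤ L := (equivSmallModel.{v} P.FullSubcategory).inverse ⋙ P.ι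
  have hi (c : C) : IsFinitelyPresentable.{v} (i.obj c) :=
    ((equivSmallModel.{v} P.FullSubcategory).inverse.obj c).property
  have : HasFilteredColimits L := by
    rw [← HasCardinalFilteredColimits_iff_hasFilteredColimits]
    infer_instance
  have := fun (J : Type v) [SmallCategory J] [IsFiltered J] ↦
    preservesColimitsOfShape_restrictedYoneda i hi J
  have hR : (restrictedYoneda i).essImage = IsIndObject (C := C) := by
    ext Q
    refine ⟨?_, fun hQ ↦ ?_⟩
    · rintro ⟨X, ⟨e⟩⟩
      -- Finitely presentable objects go to representables up to isomorphism. Every `X` is a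
      -- filtered colimit of such objects, and these colimits are preserved.
      have hPQ (Y : L) (hY : P Y) : IsIndObject ((restrictedYoneda i).obj Y) := by
        let e' : i.obj ((equivSmallModel.{v} P.FullSubcategory).functor.obj ⟨Y, hY⟩) ≅ Y :=
          P.ι.mapIso ((equivSmallModel.{v} P.FullSubcategory).unitIso.app ⟨Y, hY⟩).symm
        exact (isIndObject_yoneda _).map
          ((compRestrictedYonedaIso i).symm.app _ ≪≫ (restrictedYoneda i).mapIso e').hom
      have : Fact (Cardinal.aleph0.{v}).IsRegular := ⟨Cardinal.isRegular_aleph0⟩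
      obtain ⟨J, _, _, ⟨p⟩⟩ := (isCardinalFilteredGenerator_isCardinalPresentable L
        Cardinal.aleph0.{v}).exists_colimitsOfShape X
      have : IsFiltered J := isFiltered_of_isCardinalFiltered J Cardinal.aleph0.{v}
      let q : ObjectProperty.ColimitOfShape (IsIndObject (C := C)) J ((restrictedYoneda i).obj X) :=
        ⟨p.map (restrictedYoneda i), fun j ↦ hPQ _ (p.prop_diag_obj j)⟩
      exact q.prop.map e.hom
    · let p := hQ.presentation
      have h₁ := isColimitOfPreserves (restrictedYoneda i) (colimit.isColimit (p.F ⋙ i))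
      exact ⟨colimit (p.F ⋙ i), ⟨h₁.coconePointsIsoOfNatIso p.isColimit
        (Functor.isoWhiskerLeft p.F (compRestrictedYonedaIso i))⟩⟩
  have : (restrictedYoneda i).toEssImage.IsEquivalence := { }
  exact ⟨C, inferInstance, ⟨(restrictedYoneda i).toEssImage.asEquivalence.trans
    ((ObjectProperty.fullSubcategoryCongr hR).trans (Ind.equivalence C).symm)⟩⟩

end DefinableCat

theorem proposition2p2p7 (L : Type u) [Category.{v} L]
    (hL : DefinableCat.IsWeaklyLocallyFinitelyPresentable L) :
    DefinableCat.IsDefinable L ∧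
    (∃ (C : Type v) (_ : SmallCategory C), Nonempty (L ≌ Ind C)) ∧
    ∀ (C : Type v) [SmallCategory C], Nonempty (L ≌ Ind C) →
      DefinableCat.IsFiniteInjectivityClass (Ind.inclusion C).essImage := by
  have h (C : Type v) [SmallCategory C] : Nonempty (L ≌ Ind C) →
      DefinableCat.IsFiniteInjectivityClass (Ind.inclusion C).essImage := by
    rintro ⟨e⟩
    rw [DefinableCat.essImage_indInclusion]
    exact DefinableCat.isFiniteInjectivityClass_isIndObject (hL.hasWeakColimits.of_equivalence e)
  obtain ⟨C, _, ⟨e⟩⟩ := DefinableCat.exists_equivalence_ind L hL.isFinitelyAccessible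
  have : (Ind.inclusion C).toEssImage.IsEquivalence := { }
  exact ⟨⟨Cᵒᵖ ⥤ Type v, inferInstance, (Ind.inclusion C).essImage, inferInstance,
    (h C ⟨e⟩).isDefinableSubcategory, ⟨e.trans (Ind.inclusion C).toEssImage.asEquivalence⟩⟩,
    ⟨C, inferInstance, ⟨e⟩⟩, fun C _ ↦ h C⟩
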